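/- Let $n\ge 3$ be an integer. Let $\mathbf A_n$ be the Heyting algebra whose lattice reduct is the powerset lattice $\mathcal P(\{1,\dots,n\})$ with a new maximum $1$ added; its implication is $a\to b=1$ if $a\le b$, $1\to b=b$, and $a\to b=(\{1,\dots,n\}\setminus a)\cup b$ if $a,b\subseteq\{1,\dots,n\}$ and $a\not\subseteq b$. Let $\mathbb V(\mathbf A_n)$ be the variety generated by $\mathbf A_n$. For variables $x,y,z_1,\dots,z_{n+1}$ write $d(x)=x\vee\neg x$ and $s=z_1\vee\dots\vee z_{n+1}$, and for $1\le m\le n-1$ let $\psi_{m,n}(x,y,z_1,\dots,z_{n+1})$ be the conjunction of the equations $d(x)= d(z_i)$ $(1\le i\le n+1)$, $\ d(x)\vee\neg\neg(x\vee s)= y$, and $$\Big((s\to x)\wedge\bigwedge_{\substack{1\le i,j\le m+1\\ i\ne j}}\neg(z_i\wedge z_j)\Big)\vee\Big((s\to\neg x)\wedge\bigwedge_{\substack{m+2\le i,j\le n+1\\ i\ne j}}\neg(z_i\wedge z_j)\Big)= 1 .$$ For $1\le k\le n-1$ let $\varphi_{k,n}(x,y)$ be the primitive positive formula stating that there exist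 $w_m$ and $z_i^m$ ($1\le m\le k$, $1\le i\le n+1$) with $y=w_1\vee\dots\vee w_k$ and $\psi_{m,n}(x,w_m,z^m_1,\dots,z^m_{n+1})$ for every $m\le k$. Let $\mathsf B(n)$ be the class of all algebras isomorphic to a subalgebra of an algebra $\langle\mathbf D;\ell_1,\dots,\ell_{n-1}\rangle$, where $\mathbf D\in\mathbb V(\mathbf A_n)$ is such that each $\varphi_{k,n}$ defines a total function on $\mathbf D$ (that is, for each $a\in D$ there is exactly one $b\in D$ with $\mathbf D\vDash\varphi_{k,n}(a,b)$), and $\ell_k(a)$ is that unique $b$. Then $\mathsf B(n)$ is a variety and it has the amalgamation property: for all $\mathbf A,\mathbf B,\mathbf C\in\mathsf B(n)$ and all embeddings $h_1\colon\mathbf A\to\mathbf B$ and $h_2\colon\mathbf A\to\mathbf C$ there exist $\mathbf D\in\mathsf B(n)$ and embeddings $g_1\colon\mathbf B\to\mathbf D$ and $g_2\colon\mathbf C\to\mathbf D$ with $g_1\circ h_1=g_2\circ h_2$. In contrast, $\mathbb V(\mathbf A_n)$ does not have the amalgamation property. -/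

import Mathlib

universe u v w

namespace HeytingPP

/-- An algebra in the language of Heyting algebras expanded by unary operation symbols indexed
by `J`, whose reduct to the language of Heyting algebras is a Heyting algebra.
For `J = Empty` these are exactly the Heyting algebras. -/
structure HAlg (J : Type) : Type (u + 1) where
  /-- the universe of the algebra -/
  carrier : Type u
  /-- the Heyting algebra reduct -/
  [heyting : HeytingAlgebra carrier]
  /-- the additional unary operations -/
  op : J → carrier → carrier

attribute [instance] HAlg.heyting

instance (J : Type) : CoeSort (HAlg.{u} J) (Type u) := ⟨HAlg.carrier⟩

/-- Homomorphisms: maps preserving all operations of the language. -/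
structure Hom {J : Type} (A : HAlg.{u} J) (B : HAlg.{v} J) extends
    HeytingHom A.carrier B.carrier where
  map_op : ∀ (j : J) (a : A.carrier), toFun (A.op j a) = B.op j (toFun a)

instance {J : Type} (A : HAlg.{u} J) (B : HAlg.{v} J) :
    CoeFun (Hom A B) (fun _ => A.carrier → B.carrier) := ⟨fun h => h.toFun⟩

/-- The direct product of a family of algebras, with componentwise operations. -/
def pi {J : Type} {I : Type w} (A : I → HAlg.{u} J) : HAlg.{max w u} J where
  carrier := ∀ i, (A i).carrier
  op := fun j a i => (A i).op j (a i)

/-- A class of algebras is a variety when it is closed under homomorphic images, subalgebras and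
direct products (all of them up to isomorphism). -/
def IsVariety {J : Type} (K : HAlg.{u} J → Prop) : Prop :=
  (∀ (A B : HAlg.{u} J) (h : Hom A B), Function.Surjective h → K A → K B) ∧
  (∀ (A B : HAlg.{u} J) (h : Hom A B), Function.Injective h → K B → K A) ∧
  (∀ (I : Type u) (A : I → HAlg.{u} J), (∀ i, K (A i)) → K (pi A))

/-- The members in `Type u` of the variety generated by `M`: the homomorphic images of
subalgebras of powers of `M`. -/
def Var {J : Type} (M : HAlg.{0} J) (A : HAlg.{u} J) : Prop :=
  ∃ (I : Type u) (S : HAlg.{u} J) (i : Hom S (pi (fun _ : I => M))) (q : Hom S A),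
    Function.Injective i ∧ Function.Surjective q

/-- The amalgamation property of a class of algebras; embeddings are injective homomorphisms. -/
def AmalgamationProperty {J : Type} (K : HAlg.{u} J → Prop) : Prop :=
  ∀ (A B C : HAlg.{u} J), K A → K B → K C → ∀ (h₁ : Hom A B) (h₂ : Hom A C),
    Function.Injective h₁ → Function.Injective h₂ →
      ∃ (D : HAlg.{u} J) (g₁ : Hom B D) (g₂ : Hom C D), K D ∧
        Function.Injective g₁ ∧ Function.Injective g₂ ∧ ∀ a, g₁ (h₁ a) = g₂ (h₂ a)

/-! ### The algebras `A_n` -/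

/-- The powerset lattice of `ι` with a new maximum `⊤` added. -/
def PowTop (ι : Type) : Type := WithTop (Set ι)

noncomputable instance (ι : Type) : DistribLattice (PowTop ι) :=
  inferInstanceAs (DistribLattice (WithTop (Set ι)))

instance (ι : Type) : BoundedOrder (PowTop ι) :=
  inferInstanceAs (BoundedOrder (WithTop (Set ι)))

open Classical in
/-- The implication: `a → b` is `1` if `a ≤ b`, it is `b` if `a = 1`, and it is
`(ι - a) ∪ b` if `a` and `b` are subsets of `ι` with `a ≰ b`. (The third line of the match is
never reached.) -/
noncomputable def PowTop.imp {ι : Type} (a b : PowTop ι) : PowTop ι :=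
  if a ≤ b then ⊤ else
    match a, b with
    | none, b => b
    | some a, some b => some (aᶜ ∪ b)
    | some _, none => ⊤

theorem PowTop.le_imp_iff {ι : Type} (a b c : PowTop ι) : a ≤ PowTop.imp b c ↔ a ⊓ b ≤ c := by
  unfold PowTop.imp
  split_ifs with h
  · exact ⟨fun _ => inf_le_right.trans h, fun _ => le_top⟩
  · match a, b, c with
    | a, none, c =>
      change a ≤ c ↔ a ⊓ ⊤ ≤ c
      rw [inf_top_eq]
    | none, some b, some c =>
      have h1 : (⊤ : PowTop ι) ⊓ (some b : WithTop (Set ι)) = (some b : WithTop (Set ι)) :=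
        top_inf_eq (α := PowTop ι) _
      have h2 : ¬ ((⊤ : WithTop (Set ι)) ≤ ((bᶜ ∪ c : Set ι) : WithTop (Set ι))) := by simp
      exact ⟨fun h' => absurd h' h2, fun h' => absurd (h1 ▸ h') h⟩
    | some a, some b, some c =>
      have h1 : ((a : WithTop (Set ι)) ≤ ((bᶜ ∪ c : Set ι) : WithTop (Set ι))) ↔
          ((a : WithTop (Set ι)) ⊓ (b : WithTop (Set ι)) ≤ (c : WithTop (Set ι))) := by
        rw [← WithTop.coe_inf, WithTop.coe_le_coe, WithTop.coe_le_coe]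
        constructor
        · rintro h' x ⟨hx, hb⟩
          exact (h' hx).resolve_left (fun hn => hn hb)
        · intro h' x hx
          by_cases hb : x ∈ b
          · exact Or.inr (h' ⟨hx, hb⟩)
          · exact Or.inl hb
      exact h1
    | a, some b, none => exact absurd le_top h

noncomputable instance (ι : Type) : HeytingAlgebra (PowTop ι) :=
  HeytingAlgebra.ofHImp PowTop.imp PowTop.le_imp_iff

/-- The Heyting algebra `A_n`. -/
noncomputable def A (n : ℕ) : HAlg.{0} Empty where
  carrier := PowTop (Fin n)
  op := fun j => j.elim

/-! ### The formulas `φ_{k,n}` -/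

section Formulas

variable {D : Type u} [HeytingAlgebra D]

/-- The term `d(x) = x ∨ ¬x`. -/
def d (x : D) : D := x ⊔ xᶜ

/-- The term `s_{m,n} = z_1 ∨ … ∨ z_{n+1}` (for a fixed upper index `m` of the variables). -/
def s (n : ℕ) (z : ℕ → D) : D := (Finset.Icc 1 (n + 1)).sup z

/-- The formula `ψ_{m,n}(x, y, z_1, …, z_{n+1})`. Here `offDiag` is the set of pairs `(i, j)`
with `i ≠ j`. Only the values `z 1, …, z (n + 1)` matter. -/
def ψ (m n : ℕ) (x y : D) (z : ℕ → D) : Prop :=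
  (∀ i ∈ Finset.Icc 1 (n + 1), d x = d (z i)) ∧
  d x ⊔ (x ⊔ s n z)ᶜᶜ = y ∧
  ((s n z ⇨ x) ⊓ (Finset.Icc 1 (m + 1)).offDiag.inf (fun p => (z p.1 ⊓ z p.2)ᶜ)) ⊔
    ((s n z ⇨ xᶜ) ⊓ (Finset.Icc (m + 2) (n + 1)).offDiag.inf (fun p => (z p.1 ⊓ z p.2)ᶜ)) = ⊤

/-- The primitive positive formula `φ_{k,n}(x, y)`; `z m i` stands for the variable `z_i^m`.
Only the values `w m` and `z m i` with `1 ≤ m ≤ k` and `1 ≤ i ≤ n + 1` matter. -/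
def φ (k n : ℕ) (x y : D) : Prop :=
  ∃ (z : ℕ → ℕ → D) (w : ℕ → D),
    y = (Finset.Icc 1 k).sup w ∧ ∀ m ∈ Finset.Icc 1 k, ψ m n x (w m) (z m)

end Formulas

/-! ### The pp expansion `B(n)` -/

/-- The expansion of a Heyting algebra by unary operations. -/
def HAlg.expand {J : Type} (D : HAlg.{u} Empty) (F : J → D.carrier → D.carrier) :
    HAlg.{u} J where
  carrier := D.carrier
  op := F

/-- Given a class `K` of Heyting algebras and binary formulas `θ j` for `j : J`, the class of all
subalgebras (up to isomorphism) of the expansions `D[ℓ_j : j ∈ J]`, where `D` ranges over those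
members of `K` in which every `θ j` defines a total function, and `ℓ_j` is interpreted by it. -/
def Expansion {J : Type} (K : HAlg.{u} Empty → Prop)
    (θ : J → ∀ D : HAlg.{u} Empty, D.carrier → D.carrier → Prop) (C : HAlg.{u} J) : Prop :=
  ∃ (D : HAlg.{u} Empty) (F : J → D.carrier → D.carrier), K D ∧
    (∀ j a b, θ j D a b ↔ F j a = b) ∧ ∃ h : Hom C (D.expand F), Function.Injective h

/-- The index set of the new operation symbols: the positive integers `k ≤ n - 1`. -/
abbrev Idx (n : ℕ) : Type := {k : ℕ // 1 ≤ k ∧ k ≤ n - 1}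

/-- The pp expansion `B(n)` of the variety `V(A_n)` by the operations defined by the formulas
`φ_{k,n}` for positive `k ≤ n - 1`. -/
def B (n : ℕ) : HAlg.{u} (Idx n) → Prop :=
  Expansion (Var (A n)) (fun k D => φ (D := D.carrier) k.1 n)

end HeytingPP

namespace HeytingPP

/-! In `A n` the formula `φ k n` defines an operation (`size`) that sends proper subsets with more
than `k` elements to the coatom and everything else to `⊤`. Let `M` be `A n` with these operations
(`sizeAlg n`).

The class `B n` consists of the algebras in which every prime filter is the preimage of `⊤` under a
homomorphism to `M` (`B_iff`). This is a form of Jónsson's lemma: the condition holds in the finite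
algebra `M`, passes to powers by ultralimits, and passes to subalgebras and quotients. Primitive
positive formulas are preserved by homomorphisms and products, so Heyting homomorphisms to `A n`
respect the new operations automatically. This description makes `B n` closed under homomorphic
images, subalgebras and products.

Amalgamation rests on homogeneity of `M` (`exists_endomorphism`): two homomorphisms to `M` with the
same preimage of `⊤` differ by an automorphism. Such a homomorphism partitions the `n` points into
blocks, the new operations make block sizes readable from the preimage of `⊤`, and a permutation
matches blocks of equal size. Given `g : B → M`, the prime filter it induces on the common
subalgebra extends to `C` and comes from some `C → M`, which an automorphism corrects to agree with
`g`. The amalgam is the power of `M` indexed by all compatible pairs.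

Without the new operations block sizes are invisible. `A 2` embeds in `A n` with blocks of sizes `1,
n - 1` in either order; an amalgam would yield disjoint subsets of an `n`-element set with at least
`n - 1` elements each, impossible for `n ≥ 3`. -/

theorem compl_eq_top_iff {L : Type u} [HeytingAlgebra L] {x : L} : xᶜ = ⊤ ↔ x = ⊥ := by
  rw [← himp_bot, himp_eq_top_iff, le_bot_iff]

/-! ### Prime filters -/

/-- Prime filters of a bounded lattice, as sets. -/
structure IsPrimeFilter {L : Type u} [Lattice L] [BoundedOrder L] (Q : Set L) : Prop where
  top_mem : ⊤ ∈ Q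
  bot_notMem : ⊥ ∉ Q
  mem_of_le : ∀ {x y}, x ≤ y → x ∈ Q → y ∈ Q
  inf_mem : ∀ {x y}, x ∈ Q → y ∈ Q → x ⊓ y ∈ Q
  mem_or_mem : ∀ {x y}, x ⊔ y ∈ Q → x ∈ Q ∨ y ∈ Q

theorem IsPrimeFilter.preimage {L : Type u} {L' : Type v} [HeytingAlgebra L] [HeytingAlgebra L']
    {Q : Set L'} (hQ : IsPrimeFilter Q) (f : HeytingHom L L') : IsPrimeFilter (f ⁻¹' Q) where
  top_mem := by simpa using hQ.top_mem
  bot_notMem := by simpa using hQ.bot_notMem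
  mem_of_le h hx := hQ.mem_of_le (OrderHomClass.mono f h) hx
  inf_mem hx hy := by simpa using hQ.inf_mem hx hy
  mem_or_mem h := hQ.mem_or_mem (by simpa using h)

/-- The prime filter theorem: a filter and an ideal that do not meet are separated by a prime
filter. -/
theorem exists_isPrimeFilter {L : Type u} [DistribLattice L] [BoundedOrder L] {F I : Set L}
    (hFtop : ⊤ ∈ F) (hFle : ∀ {x y}, x ≤ y → x ∈ F → y ∈ F)
    (hFinf : ∀ {x y}, x ∈ F → y ∈ F → x ⊓ y ∈ F)
    (hIbot : ⊥ ∈ I) (hIle : ∀ {x y}, x ≤ y → y ∈ I → x ∈ I)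
    (hIsup : ∀ {x y}, x ∈ I → y ∈ I → x ⊔ y ∈ I) (hFI : ∀ x ∈ F, x ∉ I) :
    ∃ Q : Set L, IsPrimeFilter Q ∧ F ⊆ Q ∧ ∀ x ∈ I, x ∉ Q := by
  have hF : Order.IsPFilter F := Order.IsPFilter.of_def ⟨⊤, hFtop⟩
    (fun x hx y hy => ⟨x ⊓ y, hFinf hx hy, inf_le_left, inf_le_right⟩) hFle
  have hI : Order.IsIdeal I := ⟨fun x y h hx => hIle h hx, ⟨⊥, hIbot⟩,
    fun x hx y hy => ⟨x ⊔ y, hIsup hx hy, le_sup_left, le_sup_right⟩⟩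
  obtain ⟨J, hJ, hIJ, hFJ⟩ := DistribLattice.prime_ideal_of_disjoint_filter_ideal
    (F := hF.toPFilter) (I := hI.toIdeal)
    (Set.disjoint_left.2 fun x (hx : x ∈ F) (hx' : x ∈ I) => hFI x hx hx')
  have hFQ : ∀ x ∈ F, x ∉ J := fun x hx hx' => Set.disjoint_left.1 hFJ hx hx'
  refine ⟨{x | x ∉ J}, ⟨hFQ _ hFtop, fun h => h (hIJ hIbot), ?_, ?_, ?_⟩, hFQ,
    fun x hx h => h (hIJ hx)⟩
  · exact fun h hx hy => hx (J.lower h hy)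
  · exact fun hx hy h => (hJ.mem_or_mem h).elim hx hy
  · intro x y h
    by_contra! h'
    simp only [Set.mem_ofPred_eq, not_not] at h'
    exact h (J.sup_mem h'.1 h'.2)

theorem exists_isPrimeFilter_of_not_le {L : Type u} [DistribLattice L] [BoundedOrder L] {a b : L}
    (h : ¬ a ≤ b) : ∃ Q : Set L, IsPrimeFilter Q ∧ a ∈ Q ∧ b ∉ Q := by
  obtain ⟨Q, hQ, ha, hb⟩ := exists_isPrimeFilter (F := Set.Ici a) (I := Set.Iic b)
    (Set.mem_Ici.2 le_top) (fun h hx => le_trans hx h) (fun hx hy => le_inf hx hy)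
    (Set.mem_Iic.2 bot_le) (fun h hx => le_trans h hx) (fun hx hy => sup_le hx hy)
    (fun x hx hx' => h (le_trans hx hx'))
  exact ⟨Q, hQ, ha le_rfl, hb b le_rfl⟩

/-- Prime filters extend along embeddings. -/
theorem IsPrimeFilter.exists_extension {L : Type u} {L' : Type v} [HeytingAlgebra L]
    [HeytingAlgebra L'] {Q : Set L} (hQ : IsPrimeFilter Q) (f : HeytingHom L L')
    (hf : Function.Injective f) : ∃ Q' : Set L', IsPrimeFilter Q' ∧ ∀ x, f x ∈ Q' ↔ x ∈ Q := by
  obtain ⟨Q', hQ', h1, h2⟩ := exists_isPrimeFilter (L := L')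
    (F := {y | ∃ x ∈ Q, f x ≤ y}) (I := {y | ∃ x, x ∉ Q ∧ y ≤ f x})
    ⟨⊤, hQ.top_mem, le_top⟩ (fun h ⟨x, hx, hy⟩ => ⟨x, hx, hy.trans h⟩)
    (fun ⟨x, hx, hy⟩ ⟨x', hx', hy'⟩ => ⟨x ⊓ x', hQ.inf_mem hx hx', by
      rw [map_inf]; exact inf_le_inf hy hy'⟩)
    ⟨⊥, hQ.bot_notMem, bot_le⟩ (fun h ⟨x, hx, hy⟩ => ⟨x, hx, h.trans hy⟩)
    (fun ⟨x, hx, hy⟩ ⟨x', hx', hy'⟩ => ⟨x ⊔ x', fun h => (hQ.mem_or_mem h).elim hx hx', by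
      rw [map_sup]; exact sup_le_sup hy hy'⟩)
    (by
      rintro y ⟨x, hx, hy⟩ ⟨x', hx', hy'⟩
      refine hx' (hQ.mem_of_le ?_ hx)
      have h := hy.trans hy'
      rw [← inf_eq_left, ← map_inf] at h
      exact inf_eq_left.1 (hf h))
  exact ⟨Q', hQ', fun x => ⟨fun h => by_contra fun hx => h2 _ ⟨x, hx, le_rfl⟩ h,
    fun h => h1 ⟨x, h, le_rfl⟩⟩⟩

/-! ### Homomorphisms -/

namespace Hom

variable {J : Type} {A : HAlg.{u} J} {B : HAlg.{v} J} {C : HAlg.{w} J}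

theorem map_top (h : Hom A B) : h ⊤ = ⊤ := TopHomClass.map_top h.toHeytingHom
theorem map_bot (h : Hom A B) : h ⊥ = ⊥ := BotHomClass.map_bot h.toHeytingHom
theorem map_inf (h : Hom A B) (x y : A) : h (x ⊓ y) = h x ⊓ h y :=
  InfHomClass.map_inf h.toHeytingHom x y
theorem map_sup (h : Hom A B) (x y : A) : h (x ⊔ y) = h x ⊔ h y :=
  SupHomClass.map_sup h.toHeytingHom x y
theorem map_himp (h : Hom A B) (x y : A) : h (x ⇨ y) = h x ⇨ h y :=
  HeytingHomClass.map_himp h.toHeytingHom x y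
theorem map_compl (h : Hom A B) (x : A) : h xᶜ = (h x)ᶜ := _root_.map_compl h.toHeytingHom x
theorem map_bihimp (h : Hom A B) (x y : A) : h (bihimp x y) = bihimp (h x) (h y) :=
  _root_.map_bihimp h.toHeytingHom x y
theorem map_d (h : Hom A B) (x : A) : h (d x) = d (h x) := by
  unfold d; rw [h.map_sup, h.map_compl]
theorem monotone (h : Hom A B) {x y : A} (hxy : x ≤ y) : h x ≤ h y :=
  OrderHomClass.mono h.toHeytingHom hxy

/-- A map preserving the operations, as a homomorphism. -/
def ofMap (f : A.carrier → B.carrier) (hbot : f ⊥ = ⊥) (hsup : ∀ x y, f (x ⊔ y) = f x ⊔ f y)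
    (hinf : ∀ x y, f (x ⊓ y) = f x ⊓ f y) (himp : ∀ x y, f (x ⇨ y) = f x ⇨ f y)
    (hop : ∀ j x, f (A.op j x) = B.op j (f x)) : Hom A B where
  toFun := f
  map_sup' := hsup
  map_inf' := hinf
  map_bot' := hbot
  map_himp' := himp
  map_op := hop

/-- The identity homomorphism. -/
def id (A : HAlg.{u} J) : Hom A A :=
  ofMap (fun x => x) rfl (fun _ _ => rfl) (fun _ _ => rfl) (fun _ _ => rfl) (fun _ _ => rfl)

/-- Composition of homomorphisms. -/
def comp (g : Hom B C) (f : Hom A B) : Hom A C :=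
  ofMap (fun x => g (f x)) (by simp only [map_bot]) (fun x y => by simp only [map_sup])
    (fun x y => by simp only [map_inf]) (fun x y => by simp only [map_himp])
    (fun j x => (congrArg g (f.map_op j x)).trans (g.map_op j _))

/-- The homomorphism into a direct product with given components. -/
def toPi {I : Type w} {B : I → HAlg.{v} J} (f : ∀ i, Hom A (B i)) : Hom A (pi B) :=
  ofMap (fun x i => f i x) (funext fun i => (f i).map_bot)
    (fun x y => funext fun i => (f i).map_sup x y) (fun x y => funext fun i => (f i).map_inf x y)
    (fun x y => funext fun i => (f i).map_himp x y) (fun j x => funext fun i => (f i).map_op j x)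

/-- The projections of a direct product. -/
def proj {I : Type w} (B : I → HAlg.{v} J) (i : I) : Hom (pi B) (B i) :=
  ofMap (fun x => x i) rfl (fun _ _ => rfl) (fun _ _ => rfl) (fun _ _ => rfl) (fun _ _ => rfl)

/-- A homomorphism whose kernel contains that of a surjective one factors through it. -/
theorem exists_factor (q : Hom A B) (hq : Function.Surjective q) (h : Hom A C)
    (hker : ∀ x, q x = ⊤ → h x = ⊤) : ∃ g : Hom B C, ∀ x, g (q x) = h x := by
  have key : ∀ x y, q x = q y → h x = h y := by
    intro x y hxy
    -- A biimplication is `⊤` exactly when its sides are equal, so the preimage of `⊤` determines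
    -- the whole kernel.
    have h1 := hker (bihimp x y) (by rw [q.map_bihimp, hxy, bihimp_self])
    rwa [h.map_bihimp, bihimp_eq_top] at h1
  have hg : ∀ x, h (Function.surjInv hq (q x)) = h x := fun x =>
    key _ _ (Function.surjInv_eq hq _)
  refine ⟨ofMap (fun y => h (Function.surjInv hq y)) ?_ ?_ ?_ ?_ ?_, hg⟩
  · rw [← q.map_bot, hg, h.map_bot]
  · intro x y
    obtain ⟨x, rfl⟩ := hq x
    obtain ⟨y, rfl⟩ := hq y
    rw [← q.map_sup, hg, hg, hg, h.map_sup]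
  · intro x y
    obtain ⟨x, rfl⟩ := hq x
    obtain ⟨y, rfl⟩ := hq y
    rw [← q.map_inf, hg, hg, hg, h.map_inf]
  · intro x y
    obtain ⟨x, rfl⟩ := hq x
    obtain ⟨y, rfl⟩ := hq y
    rw [← q.map_himp, hg, hg, hg, h.map_himp]
  · intro j x
    obtain ⟨x, rfl⟩ := hq x
    have : B.op j (q x) = q (A.op j x) := (q.map_op j x).symm
    rw [this, hg, hg]
    exact h.map_op j x

end Hom

/-! ### Prime filters induced by homomorphisms to a finite algebra -/

/-- Every prime filter of `C` is the preimage of `⊤` under a homomorphism to `M`. -/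
def PrimeFiltersFrom {J : Type} (M : HAlg.{v} J) (C : HAlg.{u} J) : Prop :=
  ∀ Q : Set C.carrier, IsPrimeFilter Q → ∃ g : Hom C M, ∀ x, x ∈ Q ↔ g x = ⊤

namespace PrimeFiltersFrom

variable {J : Type} {M : HAlg.{v} J} {C : HAlg.{u} J} {S : HAlg.{w} J}

theorem exists_hom (hC : PrimeFiltersFrom M C) {a b : C} (h : ¬ a ≤ b) :
    ∃ g : Hom C M, g a = ⊤ ∧ g b ≠ ⊤ := by
  obtain ⟨Q, hQ, ha, hb⟩ := exists_isPrimeFilter_of_not_le h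
  obtain ⟨g, hg⟩ := hC Q hQ
  exact ⟨g, (hg a).1 ha, fun h => hb ((hg b).2 h)⟩

/-- A prime filter of the subalgebra extends to the larger algebra; restricting the homomorphism
found there suffices. -/
theorem of_injective (hC : PrimeFiltersFrom M C) (f : Hom S C) (hf : Function.Injective f) :
    PrimeFiltersFrom M S := by
  intro Q hQ
  obtain ⟨Q', hQ', h⟩ := hQ.exists_extension f.toHeytingHom hf
  obtain ⟨g, hg⟩ := hC Q' hQ'
  exact ⟨g.comp f, fun x => (h x).symm.trans (hg _)⟩

/-- The homomorphism inducing the pulled-back prime filter sends the kernel of `q` to `⊤`, so it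
factors through `q`. -/
theorem of_surjective (hC : PrimeFiltersFrom M C) (q : Hom C S) (hq : Function.Surjective q) :
    PrimeFiltersFrom M S := by
  intro Q hQ
  obtain ⟨h, hh⟩ := hC _ (hQ.preimage q.toHeytingHom)
  obtain ⟨g, hg⟩ := q.exists_factor hq h (fun x hx => (hh x).1 (by
    change q x ∈ Q
    rw [hx]; exact hQ.top_mem))
  refine ⟨g, fun y => ?_⟩
  obtain ⟨x, rfl⟩ := hq y
  rw [hg]
  exact hh x

theorem toPi_injective (hC : PrimeFiltersFrom M C) :
    Function.Injective (Hom.toPi (fun g : Hom C M => g)) := by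
  have key : ∀ a b : C, Hom.toPi (fun g : Hom C M => g) a = Hom.toPi (fun g : Hom C M => g) b →
      a ≤ b := by
    intro a b hab
    by_contra h
    obtain ⟨g, ha, hb⟩ := hC.exists_hom h
    exact hb ((congrFun hab g).symm.trans ha)
  exact fun a b hab => le_antisymm (key a b hab) (key b a hab.symm)

/-- The property passes from a finite algebra to its powers; the homomorphisms needed are
ultralimits. -/
theorem pi [Finite M.carrier] (hM : PrimeFiltersFrom M M) (I : Type w) :
    PrimeFiltersFrom M (pi (fun _ : I => M)) := by
  classical
  intro Q hQ
  -- The indicators are complemented elements, so the sets whose indicator lies in the prime filter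
  -- `Q` form an ultrafilter.
  let ind : Set I → (HeytingPP.pi (fun _ : I => M)).carrier := fun X i => if i ∈ X then ⊤ else ⊥
  have ind_pos : ∀ {X : Set I} {i : I}, i ∈ X → ind X i = ⊤ := fun h => if_pos h
  have ind_neg : ∀ {X : Set I} {i : I}, i ∉ X → ind X i = ⊥ := fun h => if_neg h
  have ind_inf : ∀ X Y, ind (X ∩ Y) = ind X ⊓ ind Y := by
    intro X Y
    funext i
    change ind (X ∩ Y) i = ind X i ⊓ ind Y i
    by_cases hX : i ∈ X
    · by_cases hY : i ∈ Y
      · rw [ind_pos hX, ind_pos hY, ind_pos (X := X ∩ Y) ⟨hX, hY⟩, inf_top_eq]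
      · rw [ind_neg hY, ind_neg (X := X ∩ Y) fun h => hY h.2, inf_bot_eq]
    · rw [ind_neg hX, ind_neg (X := X ∩ Y) fun h => hX h.1, bot_inf_eq]
  have ind_sup : ∀ X, ind X ⊔ ind Xᶜ = ⊤ := by
    intro X
    funext i
    change ind X i ⊔ ind Xᶜ i = ⊤
    by_cases hX : i ∈ X
    · rw [ind_pos hX, top_sup_eq]
    · rw [ind_pos (X := Xᶜ) hX, sup_top_eq]
  have ind_compl : ∀ X, ind X ⊓ ind Xᶜ = ⊥ := by
    intro X
    rw [← ind_inf, Set.inter_compl_self]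
    exact funext fun i => ind_neg (Set.notMem_empty i)
  have ind_univ : ind Set.univ = ⊤ := funext fun i => ind_pos (Set.mem_univ i)
  let F : Filter I :=
    { sets := {X | ind X ∈ Q}
      univ_sets := by
        change ind Set.univ ∈ Q
        rw [ind_univ]; exact hQ.top_mem
      sets_of_superset := by
        intro X Y hX hXY
        refine hQ.mem_of_le ?_ hX
        intro i
        by_cases h : i ∈ X
        · rw [ind_pos (hXY h)]; exact le_top
        · rw [ind_neg h]; exact bot_le
      inter_sets := by
        intro X Y hX hY
        change ind (X ∩ Y) ∈ Q
        rw [ind_inf]; exact hQ.inf_mem hX hY }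
  let U : Ultrafilter I := Ultrafilter.ofComplNotMemIff F (by
    intro X
    change ind Xᶜ ∉ Q ↔ ind X ∈ Q
    constructor
    · intro h
      exact (hQ.mem_or_mem (by rw [ind_sup]; exact hQ.top_mem)).resolve_right h
    · intro h h'
      exact hQ.bot_notMem (by rw [← ind_compl X]; exact hQ.inf_mem h h'))
  -- Finiteness of `M` makes every function constant along the ultrafilter.
  have hlim : ∀ f : I → M.carrier, ∃ m, ∀ᶠ i in (U : Filter I), f i = m := by
    intro f
    obtain ⟨m, hm⟩ := (U.map f).eq_pure_of_finite
    refine ⟨m, ?_⟩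
    have : {m} ∈ U.map f := by rw [hm]; exact Set.mem_singleton m
    exact this
  choose L hL using hlim
  have hLu : ∀ f m, (∀ᶠ i in (U : Filter I), f i = m) → L f = m := by
    intro f m h
    obtain ⟨i, h1, h2⟩ := ((hL f).and h).exists
    exact h1.symm.trans h2
  have hLQ : ∀ f g : (HeytingPP.pi (fun _ : I => M)).carrier,
      (∀ᶠ i in (U : Filter I), f i = g i) → f ∈ Q → g ∈ Q := by
    intro f g h hf
    have h' : ind {i | f i = g i} ∈ Q := h
    refine hQ.mem_of_le ?_ (hQ.inf_mem hf h')
    intro i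
    by_cases h : f i = g i
    · exact inf_le_left.trans h.le
    · refine inf_le_right.trans ?_
      rw [ind_neg (X := {i | f i = g i}) h]; exact bot_le
  -- `f ∈ Q` depends only on the ultralimit of `f`, hence only on the prime filter that `Q` induces
  -- on `M` along the diagonal.
  let c : Hom M (HeytingPP.pi (fun _ : I => M)) := Hom.toPi (fun _ => Hom.id M)
  obtain ⟨e, he⟩ := hM _ (hQ.preimage c.toHeytingHom)
  let l : Hom (HeytingPP.pi (fun _ : I => M)) M := Hom.ofMap L
    (hLu _ _ (Filter.Eventually.of_forall fun _ => rfl))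
    (fun f g => hLu _ _ (by
      filter_upwards [hL f, hL g] with i hf hg
      rw [← hf, ← hg]; rfl))
    (fun f g => hLu _ _ (by
      filter_upwards [hL f, hL g] with i hf hg
      rw [← hf, ← hg]; rfl))
    (fun f g => hLu _ _ (by
      filter_upwards [hL f, hL g] with i hf hg
      rw [← hf, ← hg]; rfl))
    (fun j f => hLu _ _ (by
      filter_upwards [hL f] with i hf
      rw [← hf]; rfl))
  refine ⟨e.comp l, fun f => Iff.trans ?_ (he (L f))⟩
  exact ⟨hLQ _ _ (hL f), hLQ _ _ ((hL f).mono fun _ h => h.symm)⟩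

end PrimeFiltersFrom

/-! ### Arithmetic of `PowTop` -/

namespace PowTop

variable {ι κ : Type}

/-- A subset as an element of `PowTop`. -/
def mk (s : Set ι) : PowTop ι := (s : WithTop (Set ι))

theorem eq_top_or_mk (x : PowTop ι) : x = ⊤ ∨ ∃ s, x = mk s := by
  match x with
  | none => exact Or.inl rfl
  | some s => exact Or.inr ⟨s, rfl⟩

theorem mk_le_mk {s t : Set ι} : mk s ≤ mk t ↔ s ⊆ t := WithTop.coe_le_coe
theorem mk_injective : Function.Injective (mk : Set ι → PowTop ι) := WithTop.coe_injective
theorem mk_ne_top (s : Set ι) : mk s ≠ ⊤ := WithTop.coe_ne_top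
theorem bot_eq : (⊥ : PowTop ι) = mk ∅ := rfl
theorem mk_inf (s t : Set ι) : mk s ⊓ mk t = mk (s ∩ t) := rfl
theorem mk_sup (s t : Set ι) : mk s ⊔ mk t = mk (s ∪ t) := rfl

theorem mk_himp {s t : Set ι} (h : ¬ s ⊆ t) : mk s ⇨ mk t = mk (sᶜ ∪ t) :=
  if_neg (mt mk_le_mk.1 h)

theorem mk_compl {s : Set ι} (h : s.Nonempty) : (mk s)ᶜ = mk sᶜ := by
  rw [← himp_bot, bot_eq, mk_himp (by simpa [Set.subset_empty_iff] using h.ne_empty),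
    Set.union_empty]

theorem exists_of_le_mk {x : PowTop ι} {t : Set ι} (h : x ≤ mk t) : ∃ s, x = mk s ∧ s ⊆ t := by
  rcases eq_top_or_mk x with rfl | ⟨s, rfl⟩
  · exact absurd (top_le_iff.1 h) (mk_ne_top t)
  · exact ⟨s, rfl, mk_le_mk.1 h⟩

theorem sup_eq_top {x y : PowTop ι} (h : x ⊔ y = ⊤) : x = ⊤ ∨ y = ⊤ := by
  rcases eq_top_or_mk x with rfl | ⟨s, rfl⟩
  · exact Or.inl rfl
  · rcases eq_top_or_mk y with rfl | ⟨t, rfl⟩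
    · exact Or.inr rfl
    · exact absurd h (mk_ne_top _)

theorem d_mk {s : Set ι} (h : s.Nonempty) : d (mk s) = mk Set.univ := by
  rw [d, mk_compl h, mk_sup, Set.union_compl_self]

theorem d_top : d (⊤ : PowTop ι) = ⊤ := top_sup_eq _
theorem d_bot : d (⊥ : PowTop ι) = ⊤ := by rw [d, compl_bot, sup_top_eq]

theorem exists_mk_of_d_ne_top {x : PowTop ι} (h : d x ≠ ⊤) : ∃ s : Set ι, s.Nonempty ∧ x = mk s := by
  rcases eq_top_or_mk x with rfl | ⟨s, rfl⟩
  · exact absurd d_top h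
  · refine ⟨s, Set.nonempty_iff_ne_empty.2 ?_, rfl⟩
    rintro rfl
    exact h d_bot

theorem mk_singleton_le_sup {i : ι} {x y : PowTop ι} :
    mk {i} ≤ x ⊔ y ↔ mk {i} ≤ x ∨ mk {i} ≤ y := by
  rcases eq_top_or_mk x with rfl | ⟨s, rfl⟩
  · simp
  · rcases eq_top_or_mk y with rfl | ⟨t, rfl⟩
    · simp
    · rw [mk_sup, mk_le_mk, mk_le_mk, mk_le_mk]; simp

theorem mk_singleton_le_himp {i : ι} {x y : PowTop ι} (h : mk {i} ≤ x → mk {i} ≤ y) :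
    mk {i} ≤ x ⇨ y := by
  rw [le_himp_iff]
  by_cases hx : mk {i} ≤ x
  · exact inf_le_left.trans (h hx)
  · rcases eq_top_or_mk x with rfl | ⟨s, rfl⟩
    · exact absurd le_top hx
    · rw [mk_le_mk, Set.singleton_subset_iff] at hx
      rw [mk_inf, Set.singleton_inter_eq_empty.2 hx]
      exact bot_le

/-- The map of `PowTop`s that takes preimages of subsets. -/
def comap (f : κ → ι) (x : PowTop ι) : PowTop κ := WithTop.map (fun s : Set ι => f ⁻¹' s) x

theorem comap_mk (f : κ → ι) (s : Set ι) : comap f (mk s) = mk (f ⁻¹' s) := rfl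
theorem comap_top (f : κ → ι) : comap f ⊤ = ⊤ := rfl

theorem comap_sup (f : κ → ι) (x y : PowTop ι) : comap f (x ⊔ y) = comap f x ⊔ comap f y := by
  rcases eq_top_or_mk x with rfl | ⟨s, rfl⟩
  · rw [comap_top, top_sup_eq, top_sup_eq, comap_top]
  · rcases eq_top_or_mk y with rfl | ⟨t, rfl⟩
    · rw [comap_top, sup_top_eq, sup_top_eq, comap_top]
    · rfl

theorem comap_inf (f : κ → ι) (x y : PowTop ι) : comap f (x ⊓ y) = comap f x ⊓ comap f y := by
  rcases eq_top_or_mk x with rfl | ⟨s, rfl⟩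
  · rw [comap_top, top_inf_eq, top_inf_eq]
  · rcases eq_top_or_mk y with rfl | ⟨t, rfl⟩
    · rw [comap_top, inf_top_eq, inf_top_eq]
    · rfl

/-- Surjectivity keeps a non-inclusion a non-inclusion; otherwise the implication could jump to `⊤`.
-/
theorem comap_himp {f : κ → ι} (hf : Function.Surjective f) (x y : PowTop ι) :
    comap f (x ⇨ y) = comap f x ⇨ comap f y := by
  rcases eq_top_or_mk x with rfl | ⟨s, rfl⟩
  · rw [comap_top, top_himp, top_himp]
  · rcases eq_top_or_mk y with rfl | ⟨t, rfl⟩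
    · rw [comap_top, himp_top, himp_top, comap_top]
    · by_cases h : s ⊆ t
      · rw [himp_eq_top_iff.2 (mk_le_mk.2 h), comap_mk, comap_mk,
          himp_eq_top_iff.2 (mk_le_mk.2 (Set.preimage_mono h)), comap_top]
      · rw [mk_himp h, comap_mk, comap_mk, comap_mk,
          mk_himp fun h' => h (hf.preimage_subset_preimage_iff.1 h')]
        rfl

theorem comap_injective {f : κ → ι} (hf : Function.Surjective f) : Function.Injective (comap f) :=
  WithTop.map_injective hf.preimage_injective

open Classical in
/-- The characteristic function of the prime filter of a point, with values `⊤` and `⊥`. -/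
noncomputable def point (i : ι) (x : PowTop ι) : PowTop ι := if mk {i} ≤ x then ⊤ else ⊥

theorem point_eq_top {i : ι} {x : PowTop ι} : point i x = ⊤ ↔ mk {i} ≤ x := by
  classical
  unfold point
  split_ifs with h
  · exact iff_of_true rfl h
  · exact iff_of_false (mk_ne_top ∅) h

theorem point_eq (i : ι) (x : PowTop ι) : point i x = ⊤ ∨ point i x = ⊥ := by
  classical
  unfold point
  split_ifs
  · exact Or.inl rfl
  · exact Or.inr rfl

theorem point_of_not_le {i : ι} {x : PowTop ι} (h : ¬ mk {i} ≤ x) : point i x = ⊥ :=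
  (point_eq i x).resolve_left (mt point_eq_top.1 h)

theorem point_bot (i : ι) : point i (⊥ : PowTop ι) = ⊥ :=
  point_of_not_le (by rw [bot_eq, mk_le_mk]; simp)

theorem point_sup (i : ι) (x y : PowTop ι) : point i (x ⊔ y) = point i x ⊔ point i y := by
  by_cases hx : mk {i} ≤ x
  · rw [point_eq_top.2 hx, point_eq_top.2 (mk_singleton_le_sup.2 (Or.inl hx)), top_sup_eq]
  · by_cases hy : mk {i} ≤ y
    · rw [point_eq_top.2 hy, point_eq_top.2 (mk_singleton_le_sup.2 (Or.inr hy)), sup_top_eq]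
    · rw [point_of_not_le hx, point_of_not_le hy, bot_sup_eq]
      exact point_of_not_le fun h => (mk_singleton_le_sup.1 h).elim hx hy

theorem point_inf (i : ι) (x y : PowTop ι) : point i (x ⊓ y) = point i x ⊓ point i y := by
  by_cases hx : mk {i} ≤ x
  · by_cases hy : mk {i} ≤ y
    · rw [point_eq_top.2 hx, point_eq_top.2 hy, point_eq_top.2 (le_inf hx hy), inf_top_eq]
    · rw [point_of_not_le hy, inf_bot_eq]
      exact point_of_not_le fun h => hy (h.trans inf_le_right)
  · rw [point_of_not_le hx, bot_inf_eq]
    exact point_of_not_le fun h => hx (h.trans inf_le_left)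

theorem point_himp (i : ι) (x y : PowTop ι) : point i (x ⇨ y) = point i x ⇨ point i y := by
  by_cases hx : mk {i} ≤ x
  · rw [point_eq_top.2 hx, top_himp]
    by_cases hy : mk {i} ≤ y
    · rw [point_eq_top.2 hy]
      exact point_eq_top.2 (hy.trans le_himp)
    · rw [point_of_not_le hy]
      exact point_of_not_le fun h => hy ((le_inf h hx).trans himp_inf_le)
  · rw [point_of_not_le hx, bot_himp]
    exact point_eq_top.2 (mk_singleton_le_himp fun h => absurd h hx)

instance [Finite ι] : Finite (PowTop ι) := inferInstanceAs (Finite (Option (Set ι)))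

/-- The prime filters of `PowTop ι` for finite `ι`. -/
theorem isPrimeFilter_cases [Finite ι] {Q : Set (PowTop ι)} (hQ : IsPrimeFilter Q) :
    (∀ x, x ∈ Q ↔ x = ⊤) ∨ ∃ i, ∀ x, x ∈ Q ↔ mk {i} ≤ x := by
  -- If the coatom lies in `Q`, primality and finiteness put a singleton in `Q`; if not, only `⊤`
  -- remains.
  by_cases hu : mk Set.univ ∈ Q
  · right
    have key : ∀ s : Set ι, s.Finite → mk s ∈ Q → ∃ i, mk {i} ∈ Q := by
      intro s hs
      induction s, hs using Set.Finite.induction_on with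
      | empty => exact fun h => absurd h hQ.bot_notMem
      | @insert a s _ _ ih =>
        intro h
        rw [Set.insert_eq, ← mk_sup] at h
        exact (hQ.mem_or_mem h).elim (fun h => ⟨a, h⟩) ih
    obtain ⟨i, hi⟩ := key _ Set.finite_univ hu
    refine ⟨i, fun x => ⟨fun hx => ?_, fun h => hQ.mem_of_le h hi⟩⟩
    by_contra h
    rcases eq_top_or_mk x with rfl | ⟨s, rfl⟩
    · exact h le_top
    · rw [mk_le_mk, Set.singleton_subset_iff] at h
      have := hQ.inf_mem hi hx
      rw [mk_inf, Set.singleton_inter_eq_empty.2 h] at this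
      exact hQ.bot_notMem this
  · left
    refine fun x => ⟨fun hx => ?_, fun h => h ▸ hQ.top_mem⟩
    rcases eq_top_or_mk x with rfl | ⟨s, rfl⟩
    · rfl
    · exact absurd (hQ.mem_of_le (mk_le_mk.2 (Set.subset_univ s)) hx) hu

end PowTop

/-- If unary operations on `PowTop ι` take the value `⊤` at `⊥` and `⊤`, all prime filters are
induced by endomorphisms. -/
theorem primeFiltersFrom_powTop {J ι : Type} [Finite ι] (F : J → PowTop ι → PowTop ι)
    (hF : ∀ j x, PowTop.mk Set.univ ≤ F j x) (hbot : ∀ j, F j ⊥ = ⊤) (htop : ∀ j, F j ⊤ = ⊤) :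
    PrimeFiltersFrom (⟨PowTop ι, F⟩ : HAlg.{0} J) ⟨PowTop ι, F⟩ := by
  intro Q hQ
  rcases PowTop.isPrimeFilter_cases hQ with h | ⟨i, h⟩
  · exact ⟨Hom.id _, h⟩
  · refine ⟨Hom.ofMap (PowTop.point i) (PowTop.point_bot i) (PowTop.point_sup i)
      (PowTop.point_inf i) (PowTop.point_himp i) fun j x => ?_, fun x => (h x).trans
        PowTop.point_eq_top.symm⟩
    have h1 : PowTop.point i (F j x) = ⊤ := PowTop.point_eq_top.2
      ((PowTop.mk_le_mk.2 (Set.subset_univ _)).trans (hF j x))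
    have h2 : F j (PowTop.point i x) = ⊤ := by
      rcases PowTop.point_eq i x with h | h <;> rw [h]
      · exact htop j
      · exact hbot j
    exact h1.trans h2.symm

/-! ### Counting disjoint sets -/

/-- One point chosen from each set gives an injection into `a`; when the cardinalities agree, the
chosen points exhaust `a`. -/
theorem card_le_ncard_of_disjoint {ι κ : Type} [Finite ι] {T : Finset κ} {c : κ → Set ι}
    {a : Set ι}
    (hne : ∀ i ∈ T, (c i).Nonempty) (hca : ∀ i ∈ T, c i ⊆ a)
    (hd : ∀ i ∈ T, ∀ j ∈ T, i ≠ j → Disjoint (c i) (c j)) :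
    T.card ≤ a.ncard ∧ (T.card = a.ncard → ∀ x ∈ a, ∃ i ∈ T, x ∈ c i) := by
  classical
  rcases isEmpty_or_nonempty ι with _ | _
  · have hT : T = ∅ := Finset.eq_empty_of_forall_notMem fun i hi => isEmptyElim (hne i hi).some
    exact ⟨by simp [hT], fun _ x => isEmptyElim x⟩
  choose! p hp using hne
  have hinj : Set.InjOn p T := by
    intro i hi j hj hij
    by_contra h
    exact Set.disjoint_left.1 (hd i hi j hj h) (hp i hi) (hij ▸ hp j hj)
  have hsub : p '' T ⊆ a := by
    rintro _ ⟨i, hi, rfl⟩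
    exact hca i hi (hp i hi)
  have hcard : (p '' T).ncard = T.card := by
    rw [hinj.ncard_image, Set.ncard_coe_finset]
  refine ⟨hcard ▸ Set.ncard_le_ncard hsub, fun h x hx => ?_⟩
  rw [← Set.eq_of_subset_of_ncard_le hsub (by rw [hcard, h])] at hx
  obtain ⟨i, hi, rfl⟩ := hx
  exact ⟨i, hi, hp i hi⟩

/-- All values must lie in `a`, even off `T`: the term `s` joins all the `z i`, while disjointness
is required only for indices in `T`. -/
theorem exists_injOn_of_card_le {ι : Type} [Finite ι] {T : Finset ℕ} {a : Set ι}
    (ha : a.Nonempty) (h : T.card ≤ a.ncard) :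
    ∃ f : ℕ → ι, (∀ i, f i ∈ a) ∧ Set.InjOn f T := by
  classical
  have : Fintype ι := Fintype.ofFinite ι
  obtain ⟨e⟩ : Nonempty (T ↪ a) := Function.Embedding.nonempty_of_card_le (by
    rw [Fintype.card_coe, ← Nat.card_eq_fintype_card]; exact h)
  obtain ⟨x, hx⟩ := ha
  refine ⟨fun i => if hi : i ∈ T then e ⟨i, hi⟩ else x, fun i => ?_, fun i hi j hj hij => ?_⟩
  · dsimp only
    split_ifs
    · exact Subtype.coe_prop _
    · exact hx
  · simp only [dif_pos (Finset.mem_coe.1 hi), dif_pos (Finset.mem_coe.1 hj)] at hij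
    simpa using e.injective (Subtype.ext hij)

/-! ### The formulas `φ` and homomorphisms -/

section Maps

variable {J : Type} {A : HAlg.{u} J} {B : HAlg.{v} J}

theorem Hom.map_finset_sup (h : Hom A B) (T : Finset ℕ) (w : ℕ → A.carrier) :
    h (T.sup w) = T.sup fun i => h (w i) := _root_.map_finset_sup h.toHeytingHom _ _

theorem Hom.map_closure_term (h : Hom A B) (n : ℕ) (x : A.carrier) (z : ℕ → A.carrier) :
    h (d x ⊔ (x ⊔ s n z)ᶜᶜ) = d (h x) ⊔ (h x ⊔ s n fun i => h (z i))ᶜᶜ := by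
  rw [h.map_sup, h.map_d, h.map_compl, h.map_compl, h.map_sup, s, h.map_finset_sup, s]

theorem Hom.map_disjointness_term (h : Hom A B) (m n : ℕ) (x : A.carrier) (z : ℕ → A.carrier) :
    h (((s n z ⇨ x) ⊓ (Finset.Icc 1 (m + 1)).offDiag.inf (fun p => (z p.1 ⊓ z p.2)ᶜ)) ⊔
      ((s n z ⇨ xᶜ) ⊓ (Finset.Icc (m + 2) (n + 1)).offDiag.inf (fun p => (z p.1 ⊓ z p.2)ᶜ))) =
    (((s n fun i => h (z i)) ⇨ h x) ⊓
        (Finset.Icc 1 (m + 1)).offDiag.inf (fun p => (h (z p.1) ⊓ h (z p.2))ᶜ)) ⊔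
      (((s n fun i => h (z i)) ⇨ (h x)ᶜ) ⊓
        (Finset.Icc (m + 2) (n + 1)).offDiag.inf (fun p => (h (z p.1) ⊓ h (z p.2))ᶜ)) := by
  have hinf : ∀ T : Finset (ℕ × ℕ), h (T.inf fun p => (z p.1 ⊓ z p.2)ᶜ) =
      T.inf fun p => (h (z p.1) ⊓ h (z p.2))ᶜ := by
    intro T
    refine (map_finset_inf h.toHeytingHom T _).trans (Finset.inf_congr rfl fun p _ => ?_)
    exact (h.map_compl _).trans (by rw [h.map_inf])
  rw [h.map_sup, h.map_inf, h.map_inf, h.map_himp, h.map_himp, h.map_compl, s, h.map_finset_sup,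
    hinf, hinf, s]

theorem ψ_map (h : Hom A B) {m n : ℕ} {x y : A.carrier} {z : ℕ → A.carrier}
    (H : ψ m n x y z) : ψ m n (h x) (h y) (fun i => h (z i)) := by
  obtain ⟨h1, h2, h3⟩ := H
  refine ⟨fun i hi => ?_, ?_, ?_⟩
  · rw [← h.map_d, ← h.map_d, h1 i hi]
  · rw [← h2, h.map_closure_term]
  · rw [← h.map_disjointness_term, h3, h.map_top]

/-- Existential quantification over conjunctions of equations is preserved by homomorphisms. -/
theorem φ_map (h : Hom A B) {k n : ℕ} {x y : A.carrier} (H : φ k n x y) :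
    φ k n (h x) (h y) := by
  obtain ⟨z, w, rfl, H⟩ := H
  exact ⟨fun m i => h (z m i), fun m => h (w m), h.map_finset_sup _ _,
    fun m hm => ψ_map h (H m hm)⟩

end Maps

theorem pi_ext {J : Type} {I : Type w} {A : I → HAlg.{u} J} {x y : (pi A).carrier}
    (h : ∀ i, Hom.proj A i x = Hom.proj A i y) : x = y := funext h

/-- Witnesses are chosen coordinatewise. -/
theorem φ_pi {J : Type} {I : Type w} {A : I → HAlg.{u} J} {k n : ℕ} {x y : (pi A).carrier}
    (H : ∀ i, φ k n (Hom.proj A i x) (Hom.proj A i y)) : φ k n x y := by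
  choose z w hy hψ using H
  let Z : ℕ → ℕ → (pi A).carrier := fun m j i => z i m j
  let W : ℕ → (pi A).carrier := fun m i => w i m
  refine ⟨Z, W, pi_ext fun i => ?_, fun m hm => ⟨fun j hj => pi_ext fun i => ?_,
    pi_ext fun i => ?_, pi_ext fun i => ?_⟩⟩
  · rw [Hom.map_finset_sup]
    exact hy i
  · rw [Hom.map_d, Hom.map_d]
    exact (hψ i m hm).1 j hj
  · rw [Hom.map_closure_term]
    exact (hψ i m hm).2.1
  · rw [Hom.map_disjointness_term]
    exact (hψ i m hm).2.2

/-! ### The functions defined by the formulas `φ` in `A n` -/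

namespace PowTop

variable {n : ℕ}

open Classical in
/-- The function defined by `φ k n` in `A n`: proper subsets with more than `k` elements are sent
to the coatom, everything else to `⊤`. -/
noncomputable def size (k : ℕ) (x : PowTop (Fin n)) : PowTop (Fin n) :=
  if ∃ a : Set (Fin n), x = mk a ∧ a ≠ Set.univ ∧ k < a.ncard then mk Set.univ else ⊤

theorem univ_le_size (k : ℕ) (x : PowTop (Fin n)) : mk Set.univ ≤ size k x := by
  unfold size
  split_ifs
  · exact le_rfl
  · exact le_top

theorem size_top (k : ℕ) : size k (⊤ : PowTop (Fin n)) = ⊤ :=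
  if_neg fun ⟨a, ha, _⟩ => mk_ne_top a ha.symm

theorem size_mk_eq_top {k : ℕ} {a : Set (Fin n)} :
    size k (mk a) = ⊤ ↔ a = Set.univ ∨ a.ncard ≤ k := by
  unfold size
  constructor
  · intro h
    by_contra! h'
    rw [if_pos ⟨a, rfl, h'⟩] at h
    exact mk_ne_top _ h
  · refine fun h => if_neg fun ⟨b, hb, hu, hk⟩ => ?_
    rw [mk_injective hb] at h
    exact h.elim hu (by omega)

theorem size_bot (k : ℕ) : size k (⊥ : PowTop (Fin n)) = ⊤ :=
  size_mk_eq_top.2 (Or.inr (by simp))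

theorem size_mk_of_lt {k : ℕ} {a : Set (Fin n)} (hu : a ≠ Set.univ) (hk : k < a.ncard) :
    size k (mk a) = mk Set.univ := if_pos ⟨a, rfl, hu, hk⟩

/-- The values of `y` in `ψ m n` at a nonempty set. -/
theorem value_of_ψ {m : ℕ} (hm : m + 1 ≤ n) {a : Set (Fin n)} (ha : a.Nonempty)
    {y : PowTop (Fin n)} {z : ℕ → PowTop (Fin n)} (h : ψ m n (mk a) y z) :
    (a = Set.univ → y = ⊤) ∧ (a.ncard = m → y = ⊤) ∧
      (a ≠ Set.univ → m < a.ncard → y = mk Set.univ) := by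
  -- Nothing is claimed for `a.ncard < m`, where `y` may be either the coatom or `⊤`.
  obtain ⟨h1, h2, h3⟩ := h
  rw [d_mk ha] at h1 h2
  have hz : ∀ i ∈ Finset.Icc 1 (n + 1), ∃ c : Set (Fin n), c.Nonempty ∧ z i = mk c :=
    fun i hi => exists_mk_of_d_ne_top (by rw [← h1 i hi]; exact mk_ne_top _)
  choose! c hcne hc using hz
  have hdisj : ∀ T ⊆ Finset.Icc 1 (n + 1), (T.offDiag.inf fun p => (z p.1 ⊓ z p.2)ᶜ) = ⊤ →
      ∀ i ∈ T, ∀ j ∈ T, i ≠ j → Disjoint (c i) (c j) := by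
    intro T hT hinf i hi j hj hij
    have h := (Finset.inf_eq_top_iff _ _).1 hinf (i, j) (Finset.mem_offDiag.2 ⟨hi, hj, hij⟩)
    rw [compl_eq_top_iff, hc i (hT hi), hc j (hT hj), mk_inf, bot_eq] at h
    exact Set.disjoint_iff_inter_eq_empty.2 (mk_injective h)
  have hle : ∀ i ∈ Finset.Icc 1 (n + 1), mk (c i) ≤ s n z :=
    fun i hi => hc i hi ▸ Finset.le_sup (f := z) hi
  have hcompl : a ≠ Set.univ → (mk a)ᶜᶜ = mk a := fun hu => by
    rw [mk_compl ha, mk_compl (Set.nonempty_compl.2 hu), compl_compl]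
  have hT1 : Finset.Icc 1 (m + 1) ⊆ Finset.Icc 1 (n + 1) :=
    Finset.Icc_subset_Icc le_rfl (by omega)
  have hT2 : Finset.Icc (m + 2) (n + 1) ⊆ Finset.Icc 1 (n + 1) :=
    Finset.Icc_subset_Icc (by omega) le_rfl
  -- `⊤` is join-irreducible, so one disjunct holds. In the first, `m + 1` disjoint nonempty sets
  -- lie in `a`; in the second, `n - m` lie in its complement. Thus the first forces `m < a.ncard`
  -- and the second `a.ncard ≤ m`.
  rcases sup_eq_top h3 with h3 | h3 <;> obtain ⟨h4, h5⟩ := inf_eq_top_iff.1 h3 <;>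
    rw [himp_eq_top_iff] at h4
  · obtain ⟨h6, -⟩ := card_le_ncard_of_disjoint (T := Finset.Icc 1 (m + 1)) (c := c)
      (fun i hi => hcne i (hT1 hi)) (fun i hi => mk_le_mk.1 ((hle i (hT1 hi)).trans h4))
      (hdisj _ hT1 h5)
    rw [Nat.card_Icc] at h6
    rw [sup_eq_left.2 h4] at h2
    refine ⟨?_, fun h => by omega, fun hu _ => ?_⟩
    · rintro rfl
      rw [← h2, mk_compl ha, Set.compl_univ, ← bot_eq, compl_bot, sup_top_eq]
    · rw [← h2, hcompl hu, mk_sup, Set.univ_union]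
  · have hu : a ≠ Set.univ := by
      rintro rfl
      have h := (hle 1 (by simp)).trans h4
      rw [mk_compl ha, mk_le_mk, Set.compl_univ, Set.subset_empty_iff] at h
      exact (hcne 1 (by simp)).ne_empty h
    rw [mk_compl ha] at h4
    obtain ⟨h6, h7⟩ := card_le_ncard_of_disjoint (T := Finset.Icc (m + 2) (n + 1)) (c := c)
      (fun i hi => hcne i (hT2 hi)) (fun i hi => mk_le_mk.1 ((hle i (hT2 hi)).trans h4))
      (hdisj _ hT2 h5)
    have hcard := Set.ncard_add_ncard_compl a
    rw [Nat.card_eq_fintype_card, Fintype.card_fin] at hcard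
    rw [Nat.card_Icc] at h6 h7
    refine ⟨fun h => absurd h hu, fun h => ?_, fun _ h => by omega⟩
    obtain ⟨b, hb, -⟩ := exists_of_le_mk h4
    -- For `a.ncard = m` the `n - m` disjoint sets fill the complement, so `x ⊔ s` is the coatom and
    -- its double negation is `⊤`.
    have hab : aᶜ ⊆ b := by
      intro i hi
      obtain ⟨j, hj, hij⟩ := h7 (by omega) i hi
      have := hle j (hT2 hj)
      rw [hb, mk_le_mk] at this
      exact this hij
    have hunion : a ∪ b = Set.univ := by
      rw [Set.eq_univ_iff_forall]
      exact fun i => or_iff_not_imp_left.2 fun hi => hab hi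
    rw [← h2, hb, mk_sup, hunion, mk_compl (ha.mono (Set.subset_univ a)), Set.compl_univ, ← bot_eq,
      compl_bot, sup_top_eq]

/-- Singletons serve as the `z i`: distinct points of `a` if `m < a.ncard`, of its complement
otherwise. The value `y` is then given by its defining equation. -/
theorem exists_ψ {m : ℕ} (hm : m + 1 ≤ n) (x : PowTop (Fin n)) : ∃ y z, ψ m n x y z := by
  by_cases hx : d x = ⊤
  · refine ⟨_, fun _ => ⊥, fun i _ => by rw [hx, d_bot], rfl, ?_⟩
    have hs : s n (fun _ => (⊥ : PowTop (Fin n))) = ⊥ := Finset.sup_bot _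
    have hi : ∀ T : Finset (ℕ × ℕ), (T.inf fun _ => ((⊥ : PowTop (Fin n)) ⊓ ⊥)ᶜ) = ⊤ := fun T =>
      (Finset.inf_eq_top_iff _ _).2 fun _ _ => by rw [inf_idem, compl_bot]
    rw [hs, hi, bot_himp, top_inf_eq, top_sup_eq]
  · obtain ⟨a, ha, rfl⟩ := exists_mk_of_d_ne_top hx
    have hinf : ∀ (T : Finset ℕ) (f : ℕ → Fin n), Set.InjOn f T →
        (T.offDiag.inf fun p => (mk {f p.1} ⊓ mk {f p.2})ᶜ) = ⊤ := by
      intro T f hf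
      refine (Finset.inf_eq_top_iff _ _).2 fun p hp => ?_
      obtain ⟨h1, h2, h3⟩ := Finset.mem_offDiag.1 hp
      rw [mk_inf, compl_eq_top_iff, bot_eq, Set.singleton_inter_eq_empty.2]
      exact fun h => h3 (hf h1 h2 h)
    have hd : ∀ (f : ℕ → Fin n), ∀ i ∈ Finset.Icc 1 (n + 1), d (mk a) = d (mk {f i}) :=
      fun f i _ => by rw [d_mk ha, d_mk (Set.singleton_nonempty _)]
    by_cases h : m < a.ncard
    · obtain ⟨f, hfa, hf⟩ := exists_injOn_of_card_le (T := Finset.Icc 1 (m + 1)) ha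
        (by rw [Nat.card_Icc]; omega)
      refine ⟨_, fun i => mk {f i}, hd f, rfl, ?_⟩
      have hs : s n (fun i => mk {f i}) ≤ mk a :=
        Finset.sup_le fun i _ => mk_le_mk.2 (Set.singleton_subset_iff.2 (hfa i))
      rw [hinf _ f hf, himp_eq_top_iff.2 hs, top_inf_eq, top_sup_eq]
    · have hcard := Set.ncard_add_ncard_compl a
      rw [Nat.card_eq_fintype_card, Fintype.card_fin] at hcard
      obtain ⟨f, hfa, hf⟩ := exists_injOn_of_card_le (T := Finset.Icc (m + 2) (n + 1)) (a := aᶜ)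
        (Set.nonempty_of_ncard_ne_zero (by omega)) (by rw [Nat.card_Icc]; omega)
      refine ⟨_, fun i => mk {f i}, hd f, rfl, ?_⟩
      have hs : s n (fun i => mk {f i}) ≤ (mk a)ᶜ := by
        rw [mk_compl ha]
        exact Finset.sup_le fun i _ => mk_le_mk.2 (Set.singleton_subset_iff.2 (hfa i))
      rw [hinf _ f hf, himp_eq_top_iff.2 hs, top_inf_eq, sup_top_eq]

/-- In `A n`, the formula `φ k n` defines the function `size k`. -/
theorem φ_iff {k : ℕ} (hk : 1 ≤ k) (hkn : k + 1 ≤ n) (x y : PowTop (Fin n)) :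
    φ k n x y ↔ size k x = y := by
  have key : ∀ y, φ k n x y → size k x = y := by
    rintro y ⟨z, w, rfl, H⟩
    have hd : d x ≤ (Finset.Icc 1 k).sup w := by
      have h1 : 1 ∈ Finset.Icc 1 k := by simp [hk]
      refine le_trans ?_ (Finset.le_sup (f := w) h1)
      rw [← (H 1 h1).2.1]
      exact le_sup_left
    by_cases hx : d x = ⊤
    · rw [hx, top_le_iff] at hd
      rw [hd]
      rcases eq_top_or_mk x with rfl | ⟨a, rfl⟩
      · exact size_top k
      · rcases Set.eq_empty_or_nonempty a with rfl | ha
        · exact size_bot k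
        · rw [d_mk ha] at hx
          exact absurd hx (mk_ne_top _)
    · obtain ⟨a, ha, rfl⟩ := exists_mk_of_d_ne_top hx
      have hv := fun m (hm : m ∈ Finset.Icc 1 k) =>
        value_of_ψ (by have := (Finset.mem_Icc.1 hm).2; omega) ha (H m hm)
      have htop : ∀ m ∈ Finset.Icc 1 k, w m = ⊤ → (Finset.Icc 1 k).sup w = ⊤ :=
        fun m hm h => top_le_iff.1 (h ▸ Finset.le_sup (f := w) hm)
      by_cases hu : a = Set.univ
      · rw [size_mk_eq_top.2 (Or.inl hu)]
        exact (htop 1 (by simp [hk]) ((hv 1 (by simp [hk])).1 hu)).symm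
      · by_cases hak : a.ncard ≤ k
        · have hm : a.ncard ∈ Finset.Icc 1 k :=
            Finset.mem_Icc.2 ⟨(Set.ncard_pos).2 ha, hak⟩
          rw [size_mk_eq_top.2 (Or.inr hak), htop _ hm ((hv _ hm).2.1 rfl)]
        · rw [not_le] at hak
          rw [size_mk_of_lt hu hak]
          rw [d_mk ha] at hd
          exact le_antisymm hd (Finset.sup_le fun m hm =>
            ((hv m hm).2.2 hu ((Finset.mem_Icc.1 hm).2.trans_lt hak)).le)
  refine ⟨key y, ?_⟩
  rintro rfl
  -- Uniqueness is settled by `key`, so it remains to find some value satisfying `φ`.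
  have hex : ∀ m, ∃ y z, m ∈ Finset.Icc 1 k → ψ m n x y z := by
    intro m
    by_cases hm : m ∈ Finset.Icc 1 k
    · obtain ⟨y, z, h⟩ := exists_ψ (n := n) (m := m)
        (by have := (Finset.mem_Icc.1 hm).2; omega) x
      exact ⟨y, z, fun _ => h⟩
    · exact ⟨⊥, fun _ => ⊥, fun h => absurd h hm⟩
  choose w z hψ using hex
  have h : φ k n x ((Finset.Icc 1 k).sup w) := ⟨z, w, rfl, hψ⟩
  rwa [key _ h]

end PowTop

/-! ### Members of `Var (A n)` and of `B n` -/

instance (n : ℕ) : Finite (A n).carrier := inferInstanceAs (Finite (PowTop (Fin n)))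

theorem primeFiltersFrom_A (n : ℕ) : PrimeFiltersFrom (A n) (A n) :=
  primeFiltersFrom_powTop (ι := Fin n) (fun j : Empty => j.elim) (fun j => j.elim) (fun j => j.elim)
    (fun j => j.elim)

theorem Var.primeFiltersFrom {n : ℕ} {D : HAlg.{u} Empty} (hD : Var (A n) D) :
    PrimeFiltersFrom (A n) D := by
  obtain ⟨I, S, i, q, hi, hq⟩ := hD
  exact (((primeFiltersFrom_A n).pi I).of_injective i hi).of_surjective q hq

/-- The power set algebra expanded by the functions that the formulas `φ k n` define in it. -/
noncomputable abbrev sizeAlg (n : ℕ) : HAlg.{0} (Idx n) where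
  carrier := PowTop (Fin n)
  op := fun k => PowTop.size k.1

instance (n : ℕ) : Finite (sizeAlg n).carrier := inferInstanceAs (Finite (PowTop (Fin n)))

theorem primeFiltersFrom_sizeAlg (n : ℕ) : PrimeFiltersFrom (sizeAlg n) (sizeAlg n) :=
  primeFiltersFrom_powTop (ι := Fin n) (fun (k : Idx n) => PowTop.size k.1)
    (fun _ => PowTop.univ_le_size _) (fun _ => PowTop.size_bot _) (fun _ => PowTop.size_top _)

theorem φ_iff_op {n : ℕ} (k : Idx n) (x y : (A n).carrier) :
    φ k.1 n x y ↔ (sizeAlg n).op k x = y :=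
  PowTop.φ_iff k.2.1 (by have := k.2; omega) x y

theorem var_pi (n : ℕ) (I : Type u) : Var (A n) (pi fun _ : I => A n) :=
  ⟨I, _, Hom.id _, Hom.id _, Function.injective_id, Function.surjective_id⟩

/-- For the converse direction, `C` embeds in a power of `sizeAlg n`, where each `φ` defines the
componentwise operation. -/
theorem B_iff {n : ℕ} {C : HAlg.{u} (Idx n)} : B n C ↔ PrimeFiltersFrom (sizeAlg n) C := by
  constructor
  · rintro ⟨D, F, hD, hF, h, hh⟩
    refine PrimeFiltersFrom.of_injective (C := D.expand F) ?_ h hh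
    intro Q hQ
    obtain ⟨g, hg⟩ := hD.primeFiltersFrom Q hQ
    refine ⟨⟨g.toHeytingHom, fun k a => ?_⟩, hg⟩
    -- The Heyting homomorphism `g` preserves `φ`, and `φ` defines the new operations on both sides.
    exact ((φ_iff_op k _ _).1 (φ_map g ((hF k a _).2 rfl))).symm
  · intro hC
    refine ⟨pi (fun _ : Hom C (sizeAlg n) => A n), (pi fun _ : Hom C (sizeAlg n) => sizeAlg n).op,
      var_pi n _, fun k a b => ⟨fun h => ?_, ?_⟩, Hom.toPi (fun g : Hom C (sizeAlg n) => g),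
      hC.toPi_injective⟩
    · exact funext fun g => (φ_iff_op k _ _).1 (φ_map (Hom.proj _ g) h)
    · rintro rfl
      exact φ_pi fun g => (φ_iff_op k _ _).2 rfl

/-- Each factor embeds in a power of `M`, so the product does too. -/
theorem PrimeFiltersFrom.pi_of_forall {J : Type} {M : HAlg.{v} J} [Finite M.carrier]
    (hM : PrimeFiltersFrom M M) {I : Type w} {C : I → HAlg.{u} J}
    (hC : ∀ i, PrimeFiltersFrom M (C i)) : PrimeFiltersFrom M (HeytingPP.pi C) := by
  refine (hM.pi (Σ i, Hom (C i) M)).of_injective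
    (Hom.toPi fun p => p.2.comp (Hom.proj C p.1)) fun x y hxy => ?_
  exact pi_ext fun i => (hC i).toPi_injective (funext fun g => congrFun hxy ⟨i, g⟩)

theorem isVariety_B (n : ℕ) : IsVariety (B.{u} n) := by
  refine ⟨fun A B h hh hA => ?_, fun A B h hh hB => ?_, fun I A hA => ?_⟩
  · exact B_iff.2 ((B_iff.1 hA).of_surjective h hh)
  · exact B_iff.2 ((B_iff.1 hB).of_injective h hh)
  · exact B_iff.2 ((primeFiltersFrom_sizeAlg n).pi_of_forall fun i => B_iff.1 (hA i))

/-! ### Homogeneity of the expanded algebra -/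

theorem PowTop.size_comap {n : ℕ} (e : Equiv.Perm (Fin n)) (k : ℕ) (x : PowTop (Fin n)) :
    comap e (size k x) = size k (comap e x) := by
  rcases eq_top_or_mk x with rfl | ⟨a, rfl⟩
  · rw [size_top, comap_top, size_top]
  · have hcard : (e ⁻¹' a).ncard = a.ncard :=
      Set.ncard_preimage_of_injective_subset_range e.injective (by simp)
    have huniv : e ⁻¹' a = Set.univ ↔ a = Set.univ := by
      rw [Set.preimage_eq_univ_iff, e.surjective.range_eq, Set.univ_subset_iff]
    rw [comap_mk]
    by_cases h : a = Set.univ ∨ a.ncard ≤ k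
    · rw [size_mk_eq_top.2 h, size_mk_eq_top.2 (by rwa [hcard, huniv]), comap_top]
    · rw [not_or, not_le] at h
      rw [size_mk_of_lt h.1 h.2, size_mk_of_lt (mt huniv.1 h.1) (by rw [hcard]; exact h.2)]
      rfl

/-- The automorphism induced by a permutation. -/
noncomputable def permHom {n : ℕ} (e : Equiv.Perm (Fin n)) : Hom (sizeAlg n) (sizeAlg n) :=
  Hom.ofMap (PowTop.comap e) rfl (PowTop.comap_sup e) (PowTop.comap_inf e)
    (PowTop.comap_himp e.surjective) fun k => PowTop.size_comap e k.1

section Homogeneity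

open PowTop

variable {n : ℕ} {C : HAlg.{u} (Idx n)} {f g : Hom C (sizeAlg n)}

/-- The order between two values is coded by whether an implication takes the value `⊤`. -/
theorem le_iff_of_eq_top_iff (h : ∀ x, f x = ⊤ ↔ g x = ⊤) {x y : C} :
    f x ≤ f y ↔ g x ≤ g y := by
  rw [← himp_eq_top_iff, ← himp_eq_top_iff, ← f.map_himp, ← g.map_himp, h]

/-- For `a` nonempty and proper, the operation with index `a.ncard` is `⊤` at `a`, hence at `b`,
which bounds `b.ncard` unless `b` is full. The element `e` rules that out, as fullness means lying
above the coatom. -/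
theorem ncard_le_of_eq_top_iff (h : ∀ x, f x = ⊤ ↔ g x = ⊤) {e : C} (hfe : f e = mk Set.univ)
    (hge : g e = mk Set.univ) {x : C} {a b : Set (Fin n)} (ha : f x = mk a) (hb : g x = mk b) :
    b.ncard ≤ a.ncard := by
  have huniv : a = Set.univ ↔ b = Set.univ := by
    have h1 := le_iff_of_eq_top_iff h (x := e) (y := x)
    rwa [hfe, hge, ha, hb, mk_le_mk, mk_le_mk, Set.univ_subset_iff, Set.univ_subset_iff] at h1
  by_cases hu : a = Set.univ
  · rw [hu, huniv.1 hu]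
  · rcases Set.eq_empty_or_nonempty a with rfl | hne
    · have h1 : g x ≤ g ⊥ := (le_iff_of_eq_top_iff h).1 (by rw [f.map_bot, ha]; exact le_rfl)
      rw [g.map_bot, hb] at h1
      rw [Set.subset_empty_iff.1 (mk_le_mk.1 h1)]
    · have hlt : a.ncard < n := by
        have := Set.ncard_lt_ncard (Set.ssubset_univ_iff.2 hu)
        rwa [Set.ncard_univ, Nat.card_eq_fintype_card, Fintype.card_fin] at this
      have hpos := (Set.ncard_pos).2 hne
      let k : Idx n := ⟨a.ncard, hpos, by omega⟩
      have h1 : f (C.op k x) = ⊤ := (f.map_op k x).trans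
        ((congrArg _ ha).trans (size_mk_eq_top.2 (Or.inr le_rfl)))
      have h2 : size a.ncard (mk b) = ⊤ := by
        rw [← hb]
        exact (g.map_op k x).symm.trans ((h _).1 h1)
      exact (size_mk_eq_top.1 h2).resolve_left (mt huniv.2 hu)

/-- The prime filter that a point induces through a homomorphism. -/
def pointFilter (f : Hom C (sizeAlg n)) (i : Fin n) : Set C.carrier := {x | mk {i} ≤ f x}

/-- Among the values of a homomorphism above a point there is a least one. -/
theorem exists_block (f : Hom C (sizeAlg n)) (i : Fin n) :
    ∃ x, mk {i} ≤ f x ∧ ∀ y, mk {i} ≤ f y → f x ≤ f y := by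
  obtain ⟨m, hm⟩ := (Set.toFinite (f '' pointFilter f i)).exists_minimal
    ⟨_, ⊤, by rw [pointFilter, Set.mem_ofPred_eq, f.map_top]; exact le_top, rfl⟩
  obtain ⟨⟨x, hx, rfl⟩, hmin⟩ := hm
  refine ⟨x, hx, fun y hy => ?_⟩
  have hxy : mk {i} ≤ f (x ⊓ y) := by rw [f.map_inf]; exact le_inf hx hy
  exact (hmin ⟨_, hxy, rfl⟩ (f.monotone inf_le_left)).trans (f.monotone inf_le_right)

/-- The least value above `i` is the block of `i`. By minimality it lies below `f y` or `f yᶜ` for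
every `y`; these inequalities transfer to `g`, so every point of `g x` induces the same filter as
`i`. -/
theorem mem_block_iff (h : ∀ x, f x = ⊤ ↔ g x = ⊤) {i : Fin n} {x : C} (hx : mk {i} ≤ f x)
    (hmin : ∀ y, mk {i} ≤ f y → f x ≤ f y) (j : Fin n) :
    mk {j} ≤ g x ↔ pointFilter g j = pointFilter f i := by
  refine ⟨fun hj => Set.ext fun y => ⟨fun hy => ?_, fun hy => ?_⟩, fun hj => ?_⟩
  · by_contra hy'
    have h1 : mk {i} ≤ f yᶜ := by
      rw [f.map_compl, ← himp_bot]
      exact mk_singleton_le_himp fun h => absurd h hy'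
    have h2 := hj.trans ((le_iff_of_eq_top_iff h).1 (hmin _ h1))
    rw [g.map_compl] at h2
    have h3 : mk {j} ≤ g y ⊓ (g y)ᶜ := le_inf hy h2
    rw [inf_compl_self, bot_eq, mk_le_mk, Set.subset_empty_iff] at h3
    exact Set.singleton_ne_empty j h3
  · exact hj.trans ((le_iff_of_eq_top_iff h).1 (hmin y hy))
  · have : x ∈ pointFilter g j := hj ▸ hx
    exact this

theorem ncard_fiber_eq (h : ∀ x, f x = ⊤ ↔ g x = ⊤) {e : C} (hfe : f e = mk Set.univ)
    (hge : g e = mk Set.univ) (i : Fin n) :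
    {j | pointFilter f j = pointFilter f i}.ncard =
      {j | pointFilter g j = pointFilter f i}.ncard := by
  obtain ⟨x, hx, hmin⟩ := exists_block f i
  have hxe : f x ≤ f e := hmin e (by rw [hfe]; exact mk_le_mk.2 (Set.subset_univ _))
  have hxe' : g x ≤ g e := (le_iff_of_eq_top_iff h).1 hxe
  rw [hfe] at hxe
  rw [hge] at hxe'
  obtain ⟨a, ha, -⟩ := exists_of_le_mk hxe
  obtain ⟨b, hb, -⟩ := exists_of_le_mk hxe'
  have h1 : {j | pointFilter f j = pointFilter f i} = a := Set.ext fun j => by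
    rw [Set.mem_ofPred_eq, ← mem_block_iff (fun _ => Iff.rfl) hx hmin, ha, mk_le_mk,
      Set.singleton_subset_iff]
  have h2 : {j | pointFilter g j = pointFilter f i} = b := Set.ext fun j => by
    rw [Set.mem_ofPred_eq, ← mem_block_iff h hx hmin, hb, mk_le_mk, Set.singleton_subset_iff]
  rw [h1, h2]
  exact le_antisymm (ncard_le_of_eq_top_iff (fun x => (h x).symm) hge hfe hb ha)
    (ncard_le_of_eq_top_iff h hfe hge ha hb)

/-- Two homomorphisms to the expanded power set algebra that send the same elements to `⊤` differ
by an automorphism. -/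
theorem exists_endomorphism (h : ∀ x, f x = ⊤ ↔ g x = ⊤) :
    ∃ r : Hom (sizeAlg n) (sizeAlg n), ∀ x, r (f x) = g x := by
  -- Here `f` takes only the values `⊥` and `⊤`, so it is determined by its preimage of `⊤`.
  by_cases hd : ∀ x, d (f x) = ⊤
  · refine ⟨Hom.id _, fun x => ?_⟩
    change f x = g x
    by_cases hx : f x = ⊤
    · rw [hx, (h x).1 hx]
    · have h1 : f xᶜ = ⊤ := by
        rw [f.map_compl]
        exact (sup_eq_top (hd x)).resolve_left hx
      have h2 := (h _).1 h1
      rw [f.map_compl, compl_eq_top_iff] at h1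
      rw [g.map_compl, compl_eq_top_iff] at h2
      rw [h1, h2]
  · push Not at hd
    obtain ⟨x₀, hx₀⟩ := hd
    have hcoatom : ∀ f : Hom C (sizeAlg n), d (f x₀) ≠ ⊤ → f (d x₀) = mk Set.univ := by
      intro f hf
      obtain ⟨a, ha, hfa⟩ := exists_mk_of_d_ne_top hf
      rw [f.map_d, hfa, d_mk ha]
    have hfe := hcoatom f hx₀
    have hge := hcoatom g (by rwa [← g.map_d, Ne, ← h, f.map_d])
    have hcard : ∀ c,
        Nat.card {j // pointFilter g j = c} = Nat.card {j // pointFilter f j = c} := by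
      intro c
      by_cases h1 : ∃ i, pointFilter f i = c
      · obtain ⟨i, rfl⟩ := h1
        exact (ncard_fiber_eq h hfe hge i).symm
      · by_cases h2 : ∃ i, pointFilter g i = c
        · obtain ⟨i, rfl⟩ := h2
          exact ncard_fiber_eq (fun x => (h x).symm) hge hfe i
        · have : IsEmpty {j // pointFilter f j = c} := ⟨fun j => h1 ⟨j, j.2⟩⟩
          have : IsEmpty {j // pointFilter g j = c} := ⟨fun j => h2 ⟨j, j.2⟩⟩
          rw [Nat.card_of_isEmpty, Nat.card_of_isEmpty]
    -- Blocks are the fibres of `pointFilter`; equal fibre sizes give a permutation matching the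
    -- blocks of `g` with those of `f`.
    let e : Equiv.Perm (Fin n) := Equiv.ofFiberEquiv fun c => (Finite.card_eq.1 (hcard c)).some
    have he : ∀ i, pointFilter f (e i) = pointFilter g i := Equiv.ofFiberEquiv_map _
    refine ⟨permHom e, fun x => ?_⟩
    change comap e (f x) = g x
    by_cases hx : f x = ⊤
    · rw [hx, (h x).1 hx, comap_top]
    · obtain ⟨a, ha⟩ := (eq_top_or_mk (f x)).resolve_left hx
      obtain ⟨b, hb⟩ := (eq_top_or_mk (g x)).resolve_left (mt (h x).2 hx)
      have hab : ∀ i, e i ∈ a ↔ i ∈ b := by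
        intro i
        have := Set.ext_iff.1 (he i) x
        rwa [pointFilter, pointFilter, Set.mem_ofPred_eq, Set.mem_ofPred_eq, ha, hb, mk_le_mk,
          mk_le_mk, Set.singleton_subset_iff, Set.singleton_subset_iff] at this
      rw [ha, hb, comap_mk]
      exact congrArg mk (Set.ext hab)

end Homogeneity

/-! ### Amalgamation -/

theorem isPrimeFilter_singleton_top (ι : Type) : IsPrimeFilter ({⊤} : Set (PowTop ι)) where
  top_mem := rfl
  bot_notMem := fun h => PowTop.mk_ne_top ∅ h
  mem_of_le := fun h hx => top_le_iff.1 (hx ▸ h)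
  inf_mem := fun hx hy => inf_eq_top_iff.2 ⟨hx, hy⟩
  mem_or_mem := fun h => PowTop.sup_eq_top h

/-- The prime filter that `g` induces on `A` extends to `C` and yields a homomorphism agreeing with
`g` on `A` about `⊤`; homogeneity corrects it to agree everywhere on `A`. -/
theorem exists_compatible_hom {n : ℕ} {A B C : HAlg.{u} (Idx n)}
    (hC : PrimeFiltersFrom (sizeAlg n) C) (h₁ : Hom A B) (h₂ : Hom A C)
    (hh₂ : Function.Injective h₂) (g : Hom B (sizeAlg n)) :
    ∃ g' : Hom C (sizeAlg n), ∀ a, g (h₁ a) = g' (h₂ a) := by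
  obtain ⟨Q, hQ, hQA⟩ := ((isPrimeFilter_singleton_top (Fin n)).preimage
    (g.comp h₁).toHeytingHom).exists_extension h₂.toHeytingHom hh₂
  obtain ⟨g', hg'⟩ := hC Q hQ
  obtain ⟨r, hr⟩ := exists_endomorphism (f := g'.comp h₂) (g := g.comp h₁)
    fun x => (hg' _).symm.trans (hQA x)
  exact ⟨r.comp g', fun a => (hr a).symm⟩

theorem amalgamationProperty_B (n : ℕ) : AmalgamationProperty (B.{u} n) := by
  intro A B C _ hB hC h₁ h₂ hh₁ hh₂
  rw [B_iff] at hB hC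
  let I := {p : Hom B (sizeAlg n) × Hom C (sizeAlg n) // ∀ a, p.1 (h₁ a) = p.2 (h₂ a)}
  refine ⟨pi fun _ : I => sizeAlg n, Hom.toPi fun p : I => p.1.1, Hom.toPi fun p : I => p.1.2,
    B_iff.2 ((primeFiltersFrom_sizeAlg n).pi I), fun x y hxy => ?_, fun x y hxy => ?_,
    fun a => funext fun p => p.2 a⟩
  · refine hB.toPi_injective (funext fun g => ?_)
    obtain ⟨g', hg'⟩ := exists_compatible_hom hC h₁ h₂ hh₂ g
    exact congrFun hxy ⟨(g, g'), hg'⟩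
  · refine hC.toPi_injective (funext fun g => ?_)
    obtain ⟨g', hg'⟩ := exists_compatible_hom hB h₂ h₁ hh₁ g
    exact congrFun hxy ⟨(g', g), fun a => (hg' a).symm⟩

/-! ### Failure of amalgamation in `Var (A n)` -/

-- An atom cannot go to `⊥`, since `d` of an atom is the coatom while `d ⊥ = ⊤`. So the atoms below
-- `t` have disjoint nonempty images inside the image of `t`.
open PowTop in
theorem exists_ncard_le_of_hom {n : ℕ} (g : Hom (A n) (A n))
    (hg : g (mk (Set.univ : Set (Fin n))) ≠ (⊤ : PowTop (Fin n))) (t : Set (Fin n)) :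
    ∃ t' : Set (Fin n), g (mk t) = mk t' ∧ t.ncard ≤ t'.ncard := by
  classical
  have hle : ∀ t : Set (Fin n), ∃ t' : Set (Fin n), g (mk t) = mk t' := by
    intro t
    refine (eq_top_or_mk _).resolve_left fun h => hg (top_le_iff.1 ?_)
    exact h.ge.trans (g.monotone (mk_le_mk.2 (Set.subset_univ t)))
  obtain ⟨t', ht'⟩ := hle t
  refine ⟨t', ht', ?_⟩
  choose c hc using fun i : Fin n => hle {i}
  have hne : ∀ i, (c i).Nonempty := by
    intro i
    by_contra h
    rw [Set.not_nonempty_iff_eq_empty] at h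
    refine hg ?_
    have h1 : g (mk {i}) = (⊥ : PowTop (Fin n)) := by rw [hc, h, bot_eq]
    rw [← d_mk (Set.singleton_nonempty i)]
    exact (g.map_d _).trans ((congrArg d h1).trans d_bot)
  have key := (card_le_ncard_of_disjoint (T := t.toFinset) (c := c) (a := t') (fun i _ => hne i)
    (fun i hi => ?_) fun i _ j _ hij => ?_).1
  · rwa [← Set.ncard_eq_toFinset_card'] at key
  · rw [← mk_le_mk, ← hc, ← ht']
    exact g.monotone (mk_le_mk.2 (by simpa using hi))
  · have h1 : g ((mk {i} : PowTop (Fin n)) ⊓ mk {j} : PowTop (Fin n)) = ⊥ := by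
      rw [mk_inf, Set.singleton_inter_eq_empty.2 (by simpa using hij)]
      exact g.map_bot
    have h2 : g ((mk {i} : PowTop (Fin n)) ⊓ mk {j} : PowTop (Fin n)) = mk (c i ∩ c j) :=
      (g.map_inf _ _).trans (by rw [hc, hc]; rfl)
    exact Set.disjoint_iff_inter_eq_empty.2 (mk_injective (h2.symm.trans h1))

/-- The embedding of `A m` in a copy of `A n` in `Type u` induced by a map of points. -/
noncomputable def comapHom {m n : ℕ} {f : Fin n → Fin m} (hf : Function.Surjective f) :
    Hom (pi fun _ : PUnit.{u + 1} => A m) (pi fun _ : PUnit.{u + 1} => A n) :=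
  Hom.toPi fun _ => Hom.comp (B := A m)
    (Hom.ofMap (PowTop.comap f) rfl (PowTop.comap_sup f) (PowTop.comap_inf f)
      (PowTop.comap_himp hf) fun j => j.elim) (Hom.proj _ PUnit.unit)

theorem comapHom_injective {m n : ℕ} {f : Fin n → Fin m} (hf : Function.Surjective f) :
    Function.Injective (comapHom.{u} hf) := fun _ _ hxy =>
  pi_ext fun _ => PowTop.comap_injective hf (congrFun hxy PUnit.unit)

open PowTop in
theorem not_amalgamationProperty_var {n : ℕ} (hn : 3 ≤ n) :
    ¬ AmalgamationProperty (Var.{u} (A n)) := by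
  obtain ⟨n, rfl⟩ : ∃ m, n = m + 3 := ⟨n - 3, by omega⟩
  intro hAP
  -- The map `f c` has the singleton fibre `{0}` over `c` and puts all other points over `c + 1`.
  let f : Fin 2 → Fin (n + 3) → Fin 2 := fun c i => if i = 0 then c else c + 1
  have hf : ∀ c, Function.Surjective (f c) := by
    intro c b
    by_cases h : b = c
    · exact ⟨0, by simp [f, h]⟩
    · refine ⟨1, ?_⟩
      simp only [f, Fin.one_eq_zero_iff]
      simp
      omega
  have hpre : ∀ c, f c ⁻¹' {c + 1} = {0}ᶜ := by
    intro c
    ext i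
    by_cases h : i = 0 <;> simp [f, h]
  have hcard : ({0}ᶜ : Set (Fin (n + 3))).ncard = n + 2 := by
    rw [Set.ncard_compl, Set.ncard_singleton, Nat.card_eq_fintype_card, Fintype.card_fin]
    omega
  have hV : Var.{u} (A (n + 3)) (pi fun _ => A 2) :=
    ⟨PUnit, _, comapHom (hf 0), Hom.id _, comapHom_injective _, Function.surjective_id⟩
  obtain ⟨D, g₁, g₂, hD, hg₁, -, hg⟩ := hAP _ _ _ hV (var_pi _ _) (var_pi _ _)
    (comapHom (hf 0)) (comapHom (hf 1)) (comapHom_injective _) (comapHom_injective _)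
  let h₁ := comapHom.{u} (hf 0)
  let h₂ := comapHom.{u} (hf 1)
  let δ : ∀ m, PowTop (Fin m) → (pi fun _ : PUnit.{u + 1} => A m).carrier := fun m x _ => x
  have hD' := hD.primeFiltersFrom
  have htop : ¬ ⊤ ≤ g₁ (h₁ (δ 2 (mk Set.univ))) := by
    intro h
    rw [top_le_iff, ← g₁.map_top, ← h₁.map_top] at h
    exact mk_ne_top _ (congrFun (comapHom_injective _ (hg₁ h)) PUnit.unit)
  -- A homomorphism from the amalgam to `A (n + 3)` that keeps the common coatom off `⊤` gives
  -- endomorphisms to which the counting bound applies.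
  obtain ⟨g, -, hgu⟩ := hD'.exists_hom htop
  let G₁ : Hom (A (n + 3)) (A (n + 3)) := g.comp (g₁.comp (Hom.toPi fun _ => Hom.id _))
  let G₂ : Hom (A (n + 3)) (A (n + 3)) := g.comp (g₂.comp (Hom.toPi fun _ => Hom.id _))
  have hG₁ : ∀ t : Set (Fin 2), G₁ (mk (f 0 ⁻¹' t)) = g (g₁ (h₁ (δ 2 (mk t)))) := fun _ => rfl
  have hG₂ : ∀ t : Set (Fin 2), G₂ (mk (f 1 ⁻¹' t)) = g (g₁ (h₁ (δ 2 (mk t)))) := fun t =>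
    (congrArg g (hg (δ 2 (mk t)))).symm
  have hu₁ : G₁ (mk Set.univ) ≠ (⊤ : PowTop (Fin (n + 3))) := hgu
  have hu₂ : G₂ (mk Set.univ) ≠ (⊤ : PowTop (Fin (n + 3))) := by
    rw [← Set.preimage_univ (f := f 1), hG₂]
    exact hgu
  -- In `Fin 2` the elements `0 + 1` and `1 + 1` are distinct: the two atoms of `A 2` are disjoint,
  -- and each is the large block of its own embedding.
  obtain ⟨α, hα, hα'⟩ := exists_ncard_le_of_hom G₁ hu₁ (f 0 ⁻¹' {0 + 1})
  obtain ⟨β, hβ, hβ'⟩ := exists_ncard_le_of_hom G₂ hu₂ (f 1 ⁻¹' {1 + 1})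
  have hdisj : mk (α ∩ β) = (⊥ : PowTop (Fin (n + 3))) := by
    rw [← mk_inf, ← hα, ← hβ, hG₁, hG₂]
    refine (g.map_inf _ _).symm.trans ?_
    rw [← g₁.map_inf, ← h₁.map_inf]
    have : δ 2 (mk {0 + 1}) ⊓ δ 2 (mk {1 + 1}) = ⊥ := by
      funext _
      change mk ({0 + 1} ∩ {1 + 1}) = mk ∅
      rw [Set.singleton_inter_eq_empty.2 (by decide)]
    rw [this, h₁.map_bot, g₁.map_bot, g.map_bot]
    rfl
  have hdisj' : Disjoint α β := Set.disjoint_iff_inter_eq_empty.2 (mk_injective hdisj)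
  have h3 := Set.ncard_le_ncard (Set.subset_univ (α ∪ β))
  rw [Set.ncard_union_eq hdisj', Set.ncard_univ, Nat.card_eq_fintype_card, Fintype.card_fin] at h3
  rw [hpre, hcard] at hα' hβ'
  -- Two disjoint sets of at least `n + 2` elements do not fit in `n + 3` points.
  omega

end HeytingPP

theorem mainTheorem5 (n : ℕ) (hn : 3 ≤ n) :
    HeytingPP.IsVariety (HeytingPP.B.{u} n) ∧
    HeytingPP.AmalgamationProperty (HeytingPP.B.{u} n) ∧
    ¬ HeytingPP.AmalgamationProperty (HeytingPP.Var.{u} (HeytingPP.A n)) :=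
  ⟨HeytingPP.isVariety_B n, HeytingPP.amalgamationProperty_B n,
    HeytingPP.not_amalgamationProperty_var hn⟩
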